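/- Let $1\le k\le n$, let $\mathbb{O}^{n\times k}=\{P\in\mathbb{R}^{n\times k}: P^{\rm T}P=I_k\}$, and let $f$ be a real-valued function that is differentiable on a neighborhood $\{P\in\mathbb{R}^{n\times k}:\|P^{\rm T}P-I_k\|_{\rm F}<\delta\}$, $\delta>0$, of $\mathbb{O}^{n\times k}$. Denote by $\frac{\partial f(P)}{\partial P}\in\mathbb{R}^{n\times k}$ the matrix of partial derivatives of $f$ with respect to the entries of $P$, and by $\lambda_1(A)\ge\lambda_2(A)\ge\cdots$ the eigenvalues of a symmetric matrix $A$, counted with multiplicity. A point $P\in\mathbb{O}^{n\times k}$ is a KKT point of $\max_{P\in\mathbb{O}^{n\times k}} f(P)$ if $\frac{\partial f(P)}{\partial P}=P\Lambda$ for some symmetric $\Lambda\in\mathbb{R}^{k\times k}$. Suppose that the NEPv Ansatz holds: there are a set $\mathbb{P}\subseteq\mathbb{O}^{n\times k}$, a function $H$ on $\mathbb{O}^{n\times k}$ with values in the symmetric $n\times n$ real matrices, and a constant $\omega>0$ such that, for all $\widehat P\in\mathbb{O}^{n\times k}$, $P\in\mathbb{P}$ and $\eta\in\mathbb{R}$ with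 ${\rm tr}(\widehat P^{\rm T}H(P)\widehat P)\ge{\rm tr}(P^{\rm T}H(P)P)+\eta$, there exists an orthogonal $Q\in\mathbb{O}^{k\times k}$ with $\widehat PQ\in\mathbb{P}$ and $f(\widehat PQ)\ge f(P)+\omega\eta$. Let $\{P^{(i)}\}_{i=0}^\infty$ be generated by the SCF iteration: $P^{(0)}\in\mathbb{P}$, and for each $i\ge0$, $P^{(i+1)}=\widehat P^{(i)}Q_i\in\mathbb{P}$, where $\widehat P^{(i)}\in\mathbb{O}^{n\times k}$ is an orthonormal basis matrix of an eigenspace of $H_i=H(P^{(i)})$ associated with its $k$ largest eigenvalues (that is, $H_i\widehat P^{(i)}=\widehat P^{(i)}\Omega_i$ with $\Omega_i=[\widehat P^{(i)}]^{\rm T}H_i\widehat P^{(i)}$ having eigenvalues $\lambda_1(H_i),\dots,\lambda_k(H_i)$), and $Q_i\in\mathbb{O}^{k\times k}$ is as in the Ansatz, i.e. $f(\widehat P^{(i)}Q_i)\ge f(P^{(i)})+\omega\eta_i$ with $\eta_i={\rm tr}([\widehat P^{(i)}]^{\rm T}H_i\widehat P^{(i)})-{\rm tr}([P^{(i)}]^{\rm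 T}H_iP^{(i)})$. Then: (a) The sequence $\{f(P^{(i)})\}$ is monotonically increasing (not necessarily strictly) and convergent. (b) Suppose that $H$ is continuous on $\mathbb{O}^{n\times k}$. Then every accumulation point $P_*$ of $\{P^{(i)}\}$ satisfies $P_*\in\mathbb{O}^{n\times k}$ and $H(P_*)P_*=P_*\Omega_*$ with $\Omega_*=P_*^{\rm T}H(P_*)P_*$, and the eigenvalues of $\Omega_*$ are the $k$ largest eigenvalues of $H(P_*)$, counted with multiplicity. If moreover $H(P)P-\frac{\partial f(P)}{\partial P}=P\,\mathscr{M}(P)$ for all $P\in\mathbb{O}^{n\times k}$ with some matrix-valued function $\mathscr{M}(P)\in\mathbb{R}^{k\times k}$, and $\mathscr{M}(P_*)$ is symmetric, then $P_*$ is a KKT point. (c) With $\delta_i=\lambda_k(H(P^{(i)}))-\lambda_{k+1}(H(P^{(i)}))$ and $\Lambda_i=[P^{(i)}]^{\rm T}H(P^{(i)})P^{(i)}$, $$\sum_{i=1}^\infty\delta_i\,\big\|\sin\Theta(\mathcal{R}(P^{(i+1)}),\mathcal{R}(P^{(i)}))\big\|_{\rm F}^2<\infty,\qquad \sum_{i=1}^\infty\delta_i\,\frac{\|H(P^{(i)})P^{(i)}-P^{(i)}\Lambda_i\|_{\rm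 F}^2}{\|H(P^{(i)})\|_{\rm F}^2}<\infty.$$ Here $\mathcal{R}(X)$ is the column space of $X$, and for $X,Y\in\mathbb{O}^{n\times k}$, $\Theta(\mathcal{R}(X),\mathcal{R}(Y))$ is the diagonal matrix of the canonical angles $\arccos\sigma_j(X^{\rm T}Y)$, $1\le j\le k$, where $\sigma_j$ denotes the $j$th largest singular value. A term of the second series with $H(P^{(i)})=0$ is read as $0$; for $k=n$, where $\lambda_{n+1}$ is undefined, put $\lambda_{n+1}=0$ (all terms of both series then vanish). -/

import Mathlib

open Filter Topology
open scoped Matrix Matrix.Norms.Frobenius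

namespace NEPv

/-- The Stiefel manifold: real `n × k` matrices with orthonormal columns. -/
def stiefel (n k : ℕ) : Set (Matrix (Fin n) (Fin k) ℝ) :=
  {P | Pᵀ * P = 1}

/-- The neighbourhood `{P | ‖Pᵀ P - I‖ < δ}` of the Stiefel manifold (Frobenius norm). -/
def stiefelNhd (n k : ℕ) (δ : ℝ) : Set (Matrix (Fin n) (Fin k) ℝ) :=
  {P | ‖Pᵀ * P - 1‖ < δ}

/-- The `j`-th largest eigenvalue (`j = 1, …, m`, counted with multiplicity) of a symmetric
`m × m` matrix; by convention `0` if `j` is out of range or the matrix is not symmetric. -/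
noncomputable def eigval {m : ℕ} (A : Matrix (Fin m) (Fin m) ℝ) (j : ℕ) : ℝ :=
  open scoped Classical in
  if h : A.IsHermitian ∧ 1 ≤ j ∧ j ≤ m then
    h.1.eigenvalues₀ ⟨j - 1, by
      rw [Fintype.card_fin]
      exact lt_of_lt_of_le (Nat.sub_lt h.2.1 Nat.one_pos) h.2.2⟩
  else 0

/-- The Euclidean gradient `∂f/∂P`: the matrix of partial derivatives of `f` with respect to
the entries of `P`. -/
noncomputable def euclGrad {n k : ℕ} (f : Matrix (Fin n) (Fin k) ℝ → ℝ)
    (P : Matrix (Fin n) (Fin k) ℝ) : Matrix (Fin n) (Fin k) ℝ :=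
  Matrix.of fun i j => lineDeriv ℝ f P (Matrix.single i j 1)

/-- `P` is a KKT point of the maximization of `f` over the Stiefel manifold. -/
def IsKKTPoint {n k : ℕ} (f : Matrix (Fin n) (Fin k) ℝ → ℝ)
    (P : Matrix (Fin n) (Fin k) ℝ) : Prop :=
  P ∈ stiefel n k ∧ ∃ L : Matrix (Fin k) (Fin k) ℝ, Lᵀ = L ∧ euclGrad f P = P * L

/-- `P` is an orthonormal basis matrix of an eigenspace of the symmetric matrix `A` associated
with its `k` largest eigenvalues: `A P = P Ω` with `Ω = Pᵀ A P`, and the eigenvalues of `Ω` are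
the `k` largest eigenvalues of `A`, counted with multiplicity. -/
def IsTopEigenbasis {n k : ℕ} (A : Matrix (Fin n) (Fin n) ℝ)
    (P : Matrix (Fin n) (Fin k) ℝ) : Prop :=
  P ∈ stiefel n k ∧ A * P = P * (Pᵀ * A * P) ∧
    ∀ j : ℕ, 1 ≤ j → j ≤ k → eigval (Pᵀ * A * P) j = eigval A j

/-- The orthogonal matrix `Q` turns `Phat` into an admissible matrix `Phat Q ∈ S` at which the
objective exceeds its value at `P` by at least `ω η`. -/
def IsAscentRotation {n k : ℕ} (f : Matrix (Fin n) (Fin k) ℝ → ℝ)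
    (S : Set (Matrix (Fin n) (Fin k) ℝ)) (ω η : ℝ)
    (P Phat : Matrix (Fin n) (Fin k) ℝ) (Q : Matrix (Fin k) (Fin k) ℝ) : Prop :=
  Q ∈ stiefel k k ∧ Phat * Q ∈ S ∧ f P + ω * η ≤ f (Phat * Q)

/-- The NEPv Ansatz for `f`, with symmetric matrix-valued function `H`, admissible set `S` and
constant `ω`. -/
structure Ansatz {n k : ℕ} (f : Matrix (Fin n) (Fin k) ℝ → ℝ)
    (H : Matrix (Fin n) (Fin k) ℝ → Matrix (Fin n) (Fin n) ℝ)
    (S : Set (Matrix (Fin n) (Fin k) ℝ)) (ω : ℝ) : Prop where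
  subset_stiefel : S ⊆ stiefel n k
  symm : ∀ P ∈ stiefel n k, (H P)ᵀ = H P
  omega_pos : 0 < ω
  ascent : ∀ Phat ∈ stiefel n k, ∀ P ∈ S, ∀ η : ℝ,
    (Pᵀ * H P * P).trace + η ≤ (Phatᵀ * H P * Phat).trace →
      ∃ Q : Matrix (Fin k) (Fin k) ℝ, IsAscentRotation f S ω η P Phat Q

/-- `P 0, P 1, …` is a sequence generated by the SCF iteration: `P 0 ∈ S`, and `P (i+1)` is
`Phat Q` for some orthonormal basis matrix `Phat` of an eigenspace of `H (P i)` associated with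
the `k` largest eigenvalues and some orthogonal `Q` as in the Ansatz, for the trace gain
`η = tr (Phatᵀ H(P i) Phat) - tr ((P i)ᵀ H(P i) (P i))`. -/
def IsSCFSequence {n k : ℕ} (f : Matrix (Fin n) (Fin k) ℝ → ℝ)
    (H : Matrix (Fin n) (Fin k) ℝ → Matrix (Fin n) (Fin n) ℝ)
    (S : Set (Matrix (Fin n) (Fin k) ℝ)) (ω : ℝ)
    (P : ℕ → Matrix (Fin n) (Fin k) ℝ) : Prop :=
  P 0 ∈ S ∧ ∀ i : ℕ, ∃ (Phat : Matrix (Fin n) (Fin k) ℝ) (Q : Matrix (Fin k) (Fin k) ℝ),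
    IsTopEigenbasis (H (P i)) Phat ∧
    IsAscentRotation f S ω
      ((Phatᵀ * H (P i) * Phat).trace - ((P i)ᵀ * H (P i) * P i).trace) (P i) Phat Q ∧
    P (i + 1) = Phat * Q

/-- The canonical angles `arccos σ_j(Xᵀ Y)` between the column spaces of two matrices `X`, `Y`
with orthonormal columns, in decreasing order of `σ_j`. -/
noncomputable def canonicalAngle {n k : ℕ} (X Y : Matrix (Fin n) (Fin k) ℝ) (j : Fin k) : ℝ :=
  Real.arccos ((Matrix.toEuclideanLin (Xᵀ * Y)).singularValues j)

/-- The diagonal matrix `sin Θ` of the sines of the canonical angles. -/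
noncomputable def sinTheta {n k : ℕ} (X Y : Matrix (Fin n) (Fin k) ℝ) :
    Matrix (Fin k) (Fin k) ℝ :=
  Matrix.diagonal fun j => Real.sin (canonicalAngle X Y j)

/-- The gap `λ_k(A) - λ_{k+1}(A)`. -/
noncomputable def eigGap {n : ℕ} (k : ℕ) (A : Matrix (Fin n) (Fin n) ℝ) : ℝ :=
  eigval A k - eigval A (k + 1)

end NEPv

namespace NEPv

/-! By Ky Fan (`trace_conj_le`), the trace gain of an SCF step equals the `traceDeficit` of `P i`
and is nonnegative. Each step raises `f` by at least `ω` times it. Since `f` is continuous on the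
compact Stiefel manifold, this gives (a), and telescoping makes the deficits summable; (b) and (c)
follow from that.

For (b), the deficits tend to zero, so an accumulation point maximizes the trace for its own matrix.
The equality case of Ky Fan gives the invariant subspace, and Poincaré separation identifies the
eigenvalues one by one (`isTopEigenbasis_of_trace_max`).

For (c), the deficit dominates the gap times `k - ‖Xᵀ P‖²` for a top eigenbasis `X`
(`IsTopEigenbasis.eigGap_mul_le`). That quantity is `‖sin Θ‖²` (`norm_sinTheta_sq`) and also
controls the relative residual (`norm_residual_sq_le`). -/

/-! ### Ordered spectral decomposition -/

theorem frobenius_norm_sq {m n : ℕ} (A : Matrix (Fin m) (Fin n) ℝ) :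
    ‖A‖ ^ 2 = (Aᵀ * A).trace := by
  rw [Matrix.frobenius_norm_def, ← Real.sqrt_eq_rpow, Real.sq_sqrt (by positivity),
    Finset.sum_comm]
  simp [Matrix.trace, Matrix.mul_apply, pow_two]

/-- Spectral decomposition with the eigenvalues in decreasing order. -/
theorem exists_spectral_decomposition {m : ℕ} {A : Matrix (Fin m) (Fin m) ℝ} (hA : Aᵀ = A) :
    ∃ (U : Matrix (Fin m) (Fin m) ℝ) (d : Fin m → ℝ), Uᵀ * U = 1 ∧ U * Uᵀ = 1 ∧
      A = U * Matrix.diagonal d * Uᵀ ∧ Antitone d ∧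
      ∀ j : Fin m, eigval A (j + 1) = d j := by
  have hH : A.IsHermitian := by rwa [Matrix.IsHermitian, Matrix.conjTranspose_eq_transpose_of_trivial]
  -- `eigenvalues` is indexed through the arbitrary bijection `e`; permuting the eigenvector columns
  -- by `c.trans e` restores the decreasing order of `eigenvalues₀`.
  let e : Fin (Fintype.card (Fin m)) ≃ Fin m := Fintype.equivOfCardEq (Fintype.card_fin _)
  let c : Fin m ≃ Fin (Fintype.card (Fin m)) := finCongr (Fintype.card_fin m).symm
  let W : Matrix (Fin m) (Fin m) ℝ := hH.eigenvectorUnitary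
  have hW : Wᵀ * W = 1 := by
    have := Unitary.coe_star_mul_self hH.eigenvectorUnitary
    rwa [Matrix.star_eq_conjTranspose, Matrix.conjTranspose_eq_transpose_of_trivial] at this
  have hU : (W.submatrix id (c.trans e))ᵀ * W.submatrix id (c.trans e) = 1 := by
    rw [Matrix.transpose_submatrix, Matrix.submatrix_mul _ _ _ _ _ Function.bijective_id |>.symm, hW,
      Matrix.submatrix_one_equiv]
  refine ⟨W.submatrix id (c.trans e), fun j => hH.eigenvalues₀ (c j), hU,
    mul_eq_one_comm.mp hU, ?_, ?_, ?_⟩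
  · have hs := hH.spectral_theorem
    rw [Unitary.conjStarAlgAut_apply, Matrix.star_eq_conjTranspose,
      Matrix.conjTranspose_eq_transpose_of_trivial] at hs
    have hd : Matrix.diagonal (fun j => hH.eigenvalues₀ (c j)) =
        (Matrix.diagonal hH.eigenvalues).submatrix (c.trans e) (c.trans e) := by
      rw [Matrix.submatrix_diagonal_equiv]
      congr 1
      ext j
      simp [Matrix.IsHermitian.eigenvalues, e]
    rw [hd, Matrix.transpose_submatrix, Matrix.submatrix_mul_equiv, Matrix.submatrix_mul_equiv]
    simpa using! hs
  · intro i j hij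
    exact hH.eigenvalues₀_antitone hij
  · intro j
    rw [eigval, dif_pos ⟨hH, by omega, by omega⟩]
    rfl

theorem eigval_antitone {m : ℕ} {A : Matrix (Fin m) (Fin m) ℝ} (hA : Aᵀ = A) {i j : ℕ}
    (hi : 1 ≤ i) (hij : i ≤ j) (hj : j ≤ m) : eigval A j ≤ eigval A i := by
  obtain ⟨U, d, -, -, -, hd, hv⟩ := exists_spectral_decomposition hA
  have h1 := hv ⟨i - 1, by omega⟩
  have h2 := hv ⟨j - 1, by omega⟩
  simp only [Nat.sub_add_cancel hi, Nat.sub_add_cancel (hi.trans hij)] at h1 h2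
  rw [h1, h2]
  exact hd (by simp only [Fin.mk_le_mk]; omega)

theorem trace_eq_sum_eigval {m : ℕ} {A : Matrix (Fin m) (Fin m) ℝ} (hA : Aᵀ = A) :
    A.trace = ∑ j ∈ Finset.range m, eigval A (j + 1) := by
  obtain ⟨U, d, hU, -, hAd, -, hv⟩ := exists_spectral_decomposition hA
  rw [← Fin.sum_univ_eq_sum_range (fun j => eigval A (j + 1)), Finset.sum_congr rfl fun j _ => hv j]
  rw [hAd, Matrix.trace_mul_comm, ← mul_assoc, hU, one_mul, Matrix.trace_diagonal]

/-! ### Trace inequalities in spectral coordinates -/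

section Weights

variable {n k : ℕ} {B : Matrix (Fin n) (Fin k) ℝ}

theorem weight_eq (B : Matrix (Fin n) (Fin k) ℝ) (j : Fin n) :
    (B * Bᵀ) j j = ∑ l, B j l ^ 2 := by
  simp [Matrix.mul_apply, pow_two]

theorem weight_nonneg (B : Matrix (Fin n) (Fin k) ℝ) (j : Fin n) : 0 ≤ (B * Bᵀ) j j := by
  rw [weight_eq]; positivity

/-- `1 - B Bᵀ` is a symmetric idempotent, so its diagonal entries are squared column norms. This
bounds the weights by one and shows what a weight of exactly one forces. -/
theorem one_sub_weight_eq (hB : B ∈ stiefel n k) (j : Fin n) :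
    1 - (B * Bᵀ) j j = ∑ i, ((1 - B * Bᵀ : Matrix (Fin n) (Fin n) ℝ) i j) ^ 2 := by
  have h : (1 - B * Bᵀ)ᵀ * (1 - B * Bᵀ) = 1 - B * Bᵀ := by
    have h1 : B * Bᵀ * (B * Bᵀ) = B * Bᵀ := by
      rw [Matrix.mul_assoc, ← Matrix.mul_assoc Bᵀ, hB, Matrix.one_mul]
    simp [Matrix.mul_sub, Matrix.sub_mul, h1]
  have := congrFun (congrFun h j) j
  rw [Matrix.mul_apply] at this
  simp only [Matrix.transpose_apply, Matrix.sub_apply, Matrix.one_apply_eq] at this ⊢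
  rw [← this]
  exact Finset.sum_congr rfl fun i _ => (pow_two _).symm

theorem weight_le_one (hB : B ∈ stiefel n k) (j : Fin n) : (B * Bᵀ) j j ≤ 1 := by
  have := one_sub_weight_eq hB j
  have h2 : 0 ≤ ∑ i, ((1 - B * Bᵀ : Matrix (Fin n) (Fin n) ℝ) i j) ^ 2 := by positivity
  linarith

theorem sum_weight (hB : B ∈ stiefel n k) : ∑ j, (B * Bᵀ) j j = k := by
  change (B * Bᵀ).trace = k
  rw [Matrix.trace_mul_comm, show Bᵀ * B = 1 from hB]
  simp

theorem apply_eq_zero_of_weight_eq_zero {j : Fin n} (h : (B * Bᵀ) j j = 0) (l : Fin k) :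
    B j l = 0 := by
  rw [weight_eq, Finset.sum_eq_zero_iff_of_nonneg fun _ _ => sq_nonneg _] at h
  simpa using h l

theorem one_sub_apply_eq_zero_of_weight_eq_one (hB : B ∈ stiefel n k) {j : Fin n}
    (h : (B * Bᵀ) j j = 1) (i : Fin n) : (1 - B * Bᵀ : Matrix (Fin n) (Fin n) ℝ) i j = 0 := by
  have h1 := one_sub_weight_eq hB j
  rw [h, sub_self, eq_comm, Finset.sum_eq_zero_iff_of_nonneg fun _ _ => sq_nonneg _] at h1
  simpa using h1 i

theorem trace_diagonal_conj (B : Matrix (Fin n) (Fin k) ℝ) (d : Fin n → ℝ) :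
    (Bᵀ * Matrix.diagonal d * B).trace = ∑ j, d j * (B * Bᵀ) j j := by
  rw [Matrix.trace_mul_cycle, Matrix.trace_mul_comm]
  simp [Matrix.trace]

theorem sum_ite_lt (hkn : k ≤ n) : ∑ j : Fin n, (if (j : ℕ) < k then (1 : ℝ) else 0) = k := by
  rw [Fin.sum_univ_eq_sum_range (fun j => if j < k then (1 : ℝ) else 0), ← Finset.sum_filter,
    show (Finset.range n).filter (· < k) = Finset.range k by ext; simp; omega]
  simp

/-- The weights and the indicator of the top `k` indices have the same sum, so shifting `d` by a
constant costs nothing. Taking `c` to be the `k`-th largest value makes both factors of every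
summand agree in sign. -/
theorem sum_top_sub (hkn : k ≤ n) (hB : B ∈ stiefel n k) (d : Fin n → ℝ) (c : ℝ) :
    (∑ j : Fin n, if (j : ℕ) < k then d j else 0) - ∑ j, d j * (B * Bᵀ) j j =
      ∑ j : Fin n, ((if (j : ℕ) < k then 1 else 0) - (B * Bᵀ) j j) * (d j - c) := by
  have h : ∑ j : Fin n, ((if (j : ℕ) < k then (1 : ℝ) else 0) - (B * Bᵀ) j j) * c = 0 := by
    rw [← Finset.sum_mul, Finset.sum_sub_distrib, sum_ite_lt hkn, sum_weight hB]; simp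
  refine Eq.trans ?_ (sub_zero _)
  refine Eq.trans ?_ (congrArg _ (neg_eq_zero.mpr h))
  rw [sub_neg_eq_add, ← Finset.sum_sub_distrib, ← Finset.sum_add_distrib]
  refine Finset.sum_congr rfl fun j _ => ?_
  split_ifs <;> ring

theorem top_term_nonneg (hB : B ∈ stiefel n k) {d : Fin n → ℝ} (hd : Antitone d) (p : Fin n)
    (hp : (p : ℕ) + 1 = k) (j : Fin n) :
    0 ≤ ((if (j : ℕ) < k then 1 else 0) - (B * Bᵀ) j j) * (d j - d p) := by
  split_ifs with hj
  · exact mul_nonneg (sub_nonneg.mpr (weight_le_one hB j))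
      (sub_nonneg.mpr (hd (by rw [Fin.le_def]; omega)))
  · exact mul_nonneg_of_nonpos_of_nonpos (by simpa using weight_nonneg B j)
      (sub_nonpos.mpr (hd (by rw [Fin.le_def]; omega)))

/-- Ky Fan's inequality in spectral coordinates. -/
theorem sum_weight_le_sum_top (hkn : k ≤ n) (hk : 1 ≤ k) (hB : B ∈ stiefel n k) {d : Fin n → ℝ}
    (hd : Antitone d) :
    ∑ j, d j * (B * Bᵀ) j j ≤ ∑ j : Fin n, if (j : ℕ) < k then d j else 0 := by
  rw [← sub_nonneg, sum_top_sub hkn hB d (d ⟨k - 1, by omega⟩)]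
  exact Finset.sum_nonneg fun j _ => top_term_nonneg hB hd _ (by simp; omega) j

/-- Ky Fan's inequality with the spectral gap, in spectral coordinates. -/
theorem gap_mul_le_sum_top_sub (hB : B ∈ stiefel n k) {d : Fin n → ℝ}
    (hd : Antitone d) (p q : Fin n) (hp : (p : ℕ) + 1 = k) (hq : (q : ℕ) = k) :
    (d p - d q) * ∑ j : Fin n, (if (j : ℕ) < k then 0 else (B * Bᵀ) j j) ≤
      (∑ j : Fin n, if (j : ℕ) < k then d j else 0) - ∑ j, d j * (B * Bᵀ) j j := by
  rw [sum_top_sub (by omega) hB d (d p), Finset.mul_sum]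
  refine Finset.sum_le_sum fun j _ => ?_
  have h := top_term_nonneg hB hd p hp j
  split_ifs at h ⊢ with hj
  · simpa using h
  · have h1 : d j ≤ d q := hd (by rw [Fin.le_def]; omega)
    nlinarith [weight_nonneg B j]

/-- Equality in Ky Fan's inequality forces an invariant subspace. -/
theorem diagonal_mul_eq_of_sum_top_eq (hkn : k ≤ n) (hk : 1 ≤ k) (hB : B ∈ stiefel n k)
    {d : Fin n → ℝ} (hd : Antitone d)
    (h : ∑ j, d j * (B * Bᵀ) j j = ∑ j : Fin n, if (j : ℕ) < k then d j else 0) :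
    Matrix.diagonal d * B = B * (Bᵀ * Matrix.diagonal d * B) := by
  obtain ⟨p, hp⟩ : ∃ p : Fin n, (p : ℕ) + 1 = k := ⟨⟨k - 1, by omega⟩, by simp; omega⟩
  have h0 := sum_top_sub hkn hB d (d p)
  rw [h, sub_self, eq_comm,
    Finset.sum_eq_zero_iff_of_nonneg fun j _ => top_term_nonneg hB hd p hp j] at h0
  -- Equality kills every summand, so for each `j` either `d j = d p`, or the weight is 1 (column
  -- `j` of `1 - B Bᵀ` vanishes), or it is 0 (row `j` of `B` vanishes).
  have h1 : (1 - B * Bᵀ) * (Matrix.diagonal (fun j => d j - d p) * B) = 0 := by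
    ext i l
    rw [Matrix.mul_apply]
    refine Finset.sum_eq_zero fun j _ => ?_
    rw [Matrix.diagonal_mul]
    rcases mul_eq_zero.mp (h0 j (Finset.mem_univ j)) with h2 | h2
    · split_ifs at h2
      · rw [one_sub_apply_eq_zero_of_weight_eq_one hB (by linarith), zero_mul]
      · rw [apply_eq_zero_of_weight_eq_zero (B := B) (j := j) (by linarith) l, mul_zero, mul_zero]
    · rw [h2, zero_mul, mul_zero]
  have h2 : (1 - B * Bᵀ) * B = 0 := by
    rw [Matrix.sub_mul, Matrix.mul_assoc, show Bᵀ * B = 1 from hB]; simp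
  have h3 : Matrix.diagonal (fun j => d j - d p) = Matrix.diagonal d - d p • 1 := by
    rw [← Matrix.diagonal_one, ← Matrix.diagonal_smul, Matrix.diagonal_sub]
    simp
  rw [h3, Matrix.sub_mul (Matrix.diagonal d), Matrix.mul_sub, Matrix.smul_mul, Matrix.one_mul, Matrix.mul_smul, h2,
    smul_zero, sub_zero, Matrix.sub_mul, Matrix.one_mul, sub_eq_zero] at h1
  rw [h1]
  simp only [Matrix.mul_assoc]

/-- If `B` is supported on the leading rows then `B Bᵀ` is the leading coordinate projection. -/
theorem mul_transpose_eq_of_sum_eq_zero (hkn : k ≤ n) (hB : B ∈ stiefel n k)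
    (h : ∑ j : Fin n, (if (j : ℕ) < k then 0 else (B * Bᵀ) j j) = 0) :
    B * Bᵀ = Matrix.diagonal fun j : Fin n => if (j : ℕ) < k then 1 else 0 := by
  -- The weights total `k`, so no mass outside the top `k` indices leaves each top weight equal to
  -- 1.
  have h1 : ∑ j : Fin n, (if (j : ℕ) < k then 1 - (B * Bᵀ) j j else 0) = 0 := by
    have h3 : ∀ j : Fin n, (if (j : ℕ) < k then 1 - (B * Bᵀ) j j else 0) =
        ((if (j : ℕ) < k then (1 : ℝ) else 0) - (B * Bᵀ) j j) +
          (if (j : ℕ) < k then 0 else (B * Bᵀ) j j) := by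
      intro j; split_ifs <;> ring
    rw [Finset.sum_congr rfl fun j _ => h3 j, Finset.sum_add_distrib, h,
      Finset.sum_sub_distrib, sum_ite_lt hkn, sum_weight hB]
    simp
  rw [Finset.sum_eq_zero_iff_of_nonneg fun j _ => by
    split_ifs; exacts [le_rfl, weight_nonneg B j]] at h
  rw [Finset.sum_eq_zero_iff_of_nonneg fun j _ => by
    split_ifs; exacts [sub_nonneg.mpr (weight_le_one hB j), le_rfl]] at h1
  ext i j
  by_cases hj : (j : ℕ) < k
  · have h2 := h1 j (Finset.mem_univ j)
    rw [if_pos hj] at h2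
    have h3 := one_sub_apply_eq_zero_of_weight_eq_one hB (j := j) (by linarith) i
    rw [Matrix.sub_apply, Matrix.one_apply] at h3
    rw [Matrix.diagonal_apply]
    by_cases hij : i = j
    · subst hij; rw [if_pos rfl] at h3; rw [if_pos rfl, if_pos hj]; linarith
    · rw [if_neg hij] at h3 ⊢; linarith
  · have h2 := h j (Finset.mem_univ j)
    rw [if_neg hj] at h2
    rw [Matrix.mul_apply, Matrix.diagonal_apply, Finset.sum_eq_zero fun l _ => by
      rw [Matrix.transpose_apply, apply_eq_zero_of_weight_eq_zero h2 l, mul_zero]]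
    split_ifs with h4 h5
    · exact absurd (h4 ▸ h5) hj
    · rfl
    · rfl

/-- Poincaré's inequality in spectral coordinates. -/
theorem compression_le (hB : B ∈ stiefel n k) (hkn : k ≤ n) {d : Fin n → ℝ} {e : Fin k → ℝ}
    (hd : Antitone d) (he : Antitone e) (h : Bᵀ * Matrix.diagonal d * B = Matrix.diagonal e)
    (j : Fin k) : e j ≤ d (Fin.castLE hkn j) := by
  -- Courant–Fischer by dimension count: `j + 1` unknowns against `j` equations give a nonzero `x`
  -- supported on the first `j + 1` coordinates with `B x` zero on the first `j`. Its two Rayleigh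
  -- quotients coincide and are squeezed between `e j` and `d j`.
  let ι : (Fin (j + 1) → ℝ) →ₗ[ℝ] (Fin j → ℝ) :=
    Matrix.mulVecLin (B.submatrix (fun i : Fin j => Fin.castLE hkn (Fin.castLE j.2.le i))
      (fun i : Fin (j + 1) => Fin.castLE j.2 i))
  obtain ⟨c, hc, hc0⟩ := (Submodule.ne_bot_iff _).mp
    (LinearMap.ker_ne_bot_of_finrank_lt (f := ι) (by simp))
  let x : Fin k → ℝ := fun l => if hl : (l : ℕ) < j + 1 then c ⟨l, hl⟩ else 0
  have hxc : ∀ l : Fin (j + 1), x (Fin.castLE j.2 l) = c l := fun l => dif_pos l.2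
  have hx0 : x ≠ 0 := by
    intro hx
    apply hc0
    ext l
    exact (hxc l).symm.trans (congrFun hx (Fin.castLE j.2 l))
  have hxl : ∀ l : Fin k, j < l → x l = 0 := by
    intro l hl
    rw [Fin.lt_def] at hl
    simp only [x]
    rw [dif_neg (by omega)]
  have hBx : ∀ i : Fin n, (i : ℕ) < j → (B *ᵥ x) i = 0 := by
    intro i hi
    have h1 := congrFun (LinearMap.mem_ker.mp hc) ⟨i, hi⟩
    rw [Matrix.mulVecLin_apply, Matrix.mulVec, dotProduct] at h1
    rw [Matrix.mulVec, dotProduct]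
    rw [Pi.zero_apply] at h1
    rw [← h1]
    symm
    apply Finset.sum_of_injOn (fun l : Fin (j + 1) => Fin.castLE j.2 l)
    · intro a _ b _ hab; exact Fin.castLE_injective j.2 hab
    · simp
    · intro l _ hl
      rw [hxl l, mul_zero]
      by_contra hlj
      apply hl
      rw [Fin.lt_def] at hlj
      exact ⟨⟨l, by omega⟩, by simp, rfl⟩
    · intro l _
      rw [hxc]
      rfl
  have hq : ∑ l, e l * x l ^ 2 = ∑ i, d i * (B *ᵥ x) i ^ 2 := by
    have h1 : x ⬝ᵥ ((Bᵀ * Matrix.diagonal d * B) *ᵥ x) = x ⬝ᵥ (Matrix.diagonal e *ᵥ x) := by rw [h]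
    rw [Matrix.mul_assoc, ← Matrix.mulVec_mulVec, Matrix.dotProduct_mulVec, Matrix.vecMul_transpose,
      ← Matrix.mulVec_mulVec] at h1
    simp only [dotProduct, Matrix.mulVec_diagonal] at h1
    rw [Finset.sum_congr rfl fun l _ => show e l * x l ^ 2 = x l * (e l * x l) by ring, ← h1]
    exact Finset.sum_congr rfl fun l _ => by ring
  have hn : ∑ l, x l ^ 2 = ∑ i, (B *ᵥ x) i ^ 2 := by
    have h1 : x ⬝ᵥ ((Bᵀ * B) *ᵥ x) = x ⬝ᵥ x := by
      rw [show Bᵀ * B = 1 from hB, Matrix.one_mulVec]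
    rw [← Matrix.mulVec_mulVec, Matrix.dotProduct_mulVec, Matrix.vecMul_transpose] at h1
    simp only [dotProduct, ← pow_two] at h1
    exact h1.symm
  have hpos : 0 < ∑ l, x l ^ 2 := by
    obtain ⟨l, hl⟩ := Function.ne_iff.mp hx0
    exact Finset.sum_pos' (fun _ _ => sq_nonneg _) ⟨l, Finset.mem_univ l, by
      have : x l ≠ 0 := hl
      positivity⟩
  have h1 : e j * ∑ l, x l ^ 2 ≤ ∑ l, e l * x l ^ 2 := by
    rw [Finset.mul_sum]
    refine Finset.sum_le_sum fun l _ => ?_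
    rcases le_or_gt l j with hl | hl
    · exact mul_le_mul_of_nonneg_right (he hl) (sq_nonneg _)
    · simp [hxl l hl]
  have h2 : ∑ i, d i * (B *ᵥ x) i ^ 2 ≤ d (Fin.castLE hkn j) * ∑ i, (B *ᵥ x) i ^ 2 := by
    rw [Finset.mul_sum]
    refine Finset.sum_le_sum fun i _ => ?_
    rcases lt_or_ge (i : ℕ) j with hi | hi
    · simp [hBx i hi]
    · exact mul_le_mul_of_nonneg_right (hd (by rwa [Fin.le_def])) (sq_nonneg _)
  rw [← hn, ← hq] at h2
  exact le_of_mul_le_mul_right (h1.trans h2) hpos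

end Weights

/-! ### Ky Fan, Poincaré separation and the gap estimate -/

variable {n k : ℕ}

theorem mul_mem_stiefel {m : ℕ} {X : Matrix (Fin n) (Fin m) ℝ} {Y : Matrix (Fin m) (Fin k) ℝ}
    (hX : X ∈ stiefel n m) (hY : Y ∈ stiefel m k) : X * Y ∈ stiefel n k := by
  change (X * Y)ᵀ * (X * Y) = 1
  rw [Matrix.transpose_mul, Matrix.mul_assoc, ← Matrix.mul_assoc Xᵀ, show Xᵀ * X = 1 from hX,
    Matrix.one_mul, hY]

theorem transpose_conj {A : Matrix (Fin n) (Fin n) ℝ} (hA : Aᵀ = A)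
    (P : Matrix (Fin n) (Fin k) ℝ) : (Pᵀ * A * P)ᵀ = Pᵀ * A * P := by
  simp [Matrix.transpose_mul, hA, Matrix.mul_assoc]

theorem conj_spectral (U : Matrix (Fin n) (Fin n) ℝ) (D : Matrix (Fin n) (Fin n) ℝ)
    (P : Matrix (Fin n) (Fin k) ℝ) :
    Pᵀ * (U * D * Uᵀ) * P = (Uᵀ * P)ᵀ * D * (Uᵀ * P) := by
  simp [Matrix.transpose_mul, Matrix.mul_assoc]

theorem sum_top_eq_sum_eigval (hkn : k ≤ n) {A : Matrix (Fin n) (Fin n) ℝ} {d : Fin n → ℝ}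
    (hv : ∀ j : Fin n, eigval A (j + 1) = d j) :
    (∑ j : Fin n, if (j : ℕ) < k then d j else 0) = ∑ j ∈ Finset.range k, eigval A (j + 1) := by
  rw [Finset.sum_congr rfl fun j _ => by rw [← hv j],
    Fin.sum_univ_eq_sum_range (fun j => if j < k then eigval A (j + 1) else 0),
    ← Finset.sum_filter,
    show (Finset.range n).filter (· < k) = Finset.range k by ext; simp; omega]

/-- Ky Fan's inequality. -/
theorem trace_conj_le (hk : 1 ≤ k) (hkn : k ≤ n) {A : Matrix (Fin n) (Fin n) ℝ} (hA : Aᵀ = A)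
    {P : Matrix (Fin n) (Fin k) ℝ} (hP : P ∈ stiefel n k) :
    (Pᵀ * A * P).trace ≤ ∑ j ∈ Finset.range k, eigval A (j + 1) := by
  obtain ⟨U, d, hU, hU', hAd, hd, hv⟩ := exists_spectral_decomposition hA
  have hB : Uᵀ * P ∈ stiefel n k :=
    mul_mem_stiefel (show Uᵀ ∈ stiefel n n by simpa [stiefel] using hU') hP
  rw [← sum_top_eq_sum_eigval hkn hv, hAd, conj_spectral, trace_diagonal_conj]
  exact sum_weight_le_sum_top hkn hk hB hd

/-- The bound in Ky Fan's inequality is attained. -/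
theorem exists_trace_conj_eq (hkn : k ≤ n) {A : Matrix (Fin n) (Fin n) ℝ} (hA : Aᵀ = A) :
    ∃ X ∈ stiefel n k, (Xᵀ * A * X).trace = ∑ j ∈ Finset.range k, eigval A (j + 1) := by
  obtain ⟨U, d, hU, hU', hAd, hd, hv⟩ := exists_spectral_decomposition hA
  let J : Matrix (Fin n) (Fin k) ℝ := (1 : Matrix (Fin n) (Fin n) ℝ).submatrix id (Fin.castLE hkn)
  have hJ : J ∈ stiefel n k := by
    change Jᵀ * J = 1
    rw [Matrix.transpose_submatrix, ← Matrix.submatrix_mul _ _ _ _ _ Function.bijective_id,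
      Matrix.transpose_one, Matrix.one_mul, Matrix.submatrix_one _ (Fin.castLE_injective hkn)]
  refine ⟨U * J, mul_mem_stiefel hU hJ, ?_⟩
  have hUJ : Uᵀ * (U * J) = J := by rw [← Matrix.mul_assoc, hU, Matrix.one_mul]
  have hc : (U * J)ᵀ * A * (U * J) = Jᵀ * Matrix.diagonal d * J := by
    conv_lhs => rw [hAd]
    rw [conj_spectral, hUJ]
  rw [hc]
  have h1 : Jᵀ * Matrix.diagonal d * J = Matrix.diagonal fun l => d (Fin.castLE hkn l) := by
    ext i j
    simp only [J, Matrix.mul_apply, Matrix.diagonal_apply, Matrix.one_apply,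
      Matrix.transpose_apply, Matrix.submatrix_apply, id_eq]
    rcases eq_or_ne i j with rfl | hij
    · simp
    · simp [hij, hij.symm]
  rw [h1, Matrix.trace_diagonal, ← Fin.sum_univ_eq_sum_range (fun j => eigval A (j + 1))]
  exact Finset.sum_congr rfl fun l _ => (hv (Fin.castLE hkn l)).symm

/-- Poincaré's separation inequality. -/
theorem eigval_conj_le (hkn : k ≤ n) {A : Matrix (Fin n) (Fin n) ℝ} (hA : Aᵀ = A)
    {P : Matrix (Fin n) (Fin k) ℝ} (hP : P ∈ stiefel n k) {j : ℕ} (hj : j < k) :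
    eigval (Pᵀ * A * P) (j + 1) ≤ eigval A (j + 1) := by
  obtain ⟨U, d, hU, hU', hAd, hd, hv⟩ := exists_spectral_decomposition hA
  obtain ⟨V, e, hV, -, hΩ, he, hw⟩ := exists_spectral_decomposition (transpose_conj hA P)
  have hB : Uᵀ * (P * V) ∈ stiefel n k :=
    mul_mem_stiefel (show Uᵀ ∈ stiefel n n by simpa [stiefel] using hU') (mul_mem_stiefel hP hV)
  have h1 : (Uᵀ * (P * V))ᵀ * Matrix.diagonal d * (Uᵀ * (P * V)) = Matrix.diagonal e := by
    rw [← conj_spectral, ← hAd]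
    calc (P * V)ᵀ * A * (P * V) = Vᵀ * (Pᵀ * A * P) * V := by
          simp [Matrix.transpose_mul, Matrix.mul_assoc]
      _ = Vᵀ * (V * Matrix.diagonal e * Vᵀ) * V := by rw [← hΩ]
      _ = (Vᵀ * V) * Matrix.diagonal e * (Vᵀ * V) := by simp [Matrix.mul_assoc]
      _ = Matrix.diagonal e := by rw [hV]; simp
  have h2 := compression_le hB hkn hd he h1 ⟨j, hj⟩
  rwa [← hv, ← hw] at h2

/-- Maximizers of the trace are top eigenbases. -/
theorem isTopEigenbasis_of_trace_max (hk : 1 ≤ k) (hkn : k ≤ n) {A : Matrix (Fin n) (Fin n) ℝ}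
    (hA : Aᵀ = A) {P : Matrix (Fin n) (Fin k) ℝ} (hP : P ∈ stiefel n k)
    (hmax : ∀ X ∈ stiefel n k, (Xᵀ * A * X).trace ≤ (Pᵀ * A * P).trace) :
    IsTopEigenbasis A P := by
  have htr : (Pᵀ * A * P).trace = ∑ j ∈ Finset.range k, eigval A (j + 1) := by
    obtain ⟨X, hX, h⟩ := exists_trace_conj_eq hkn hA
    exact le_antisymm (trace_conj_le hk hkn hA hP) (h ▸ hmax X hX)
  refine ⟨hP, ?_, ?_⟩
  · obtain ⟨U, d, hU, hU', hAd, hd, hv⟩ := exists_spectral_decomposition hA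
    have hB : Uᵀ * P ∈ stiefel n k :=
      mul_mem_stiefel (show Uᵀ ∈ stiefel n n by simpa [stiefel] using hU') hP
    have h1 := htr
    rw [← sum_top_eq_sum_eigval hkn hv, hAd, conj_spectral, trace_diagonal_conj] at h1
    have h2 := diagonal_mul_eq_of_sum_top_eq hkn hk hB hd h1
    rw [← conj_spectral, ← hAd] at h2
    calc A * P = U * (Matrix.diagonal d * (Uᵀ * P)) := by
          conv_lhs => rw [hAd]
          simp only [Matrix.mul_assoc]
      _ = (U * Uᵀ) * P * (Pᵀ * A * P) := by rw [h2]; simp only [Matrix.mul_assoc]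
      _ = P * (Pᵀ * A * P) := by rw [hU', Matrix.one_mul]
  -- Eigenvalues bounded termwise with equal sums must agree termwise.
  · have h1 : ∀ j ∈ Finset.range k, eigval (Pᵀ * A * P) (j + 1) ≤ eigval A (j + 1) :=
      fun j hj => eigval_conj_le hkn hA hP (Finset.mem_range.mp hj)
    rw [trace_eq_sum_eigval (transpose_conj hA P), Finset.sum_eq_sum_iff_of_le h1] at htr
    intro j hj1 hjk
    have := htr (j - 1) (Finset.mem_range.mpr (by omega))
    rwa [Nat.sub_add_cancel hj1] at this

theorem IsTopEigenbasis.trace_eq {A : Matrix (Fin n) (Fin n) ℝ} (hA : Aᵀ = A)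
    {P : Matrix (Fin n) (Fin k) ℝ} (hP : IsTopEigenbasis A P) :
    (Pᵀ * A * P).trace = ∑ j ∈ Finset.range k, eigval A (j + 1) := by
  rw [trace_eq_sum_eigval (transpose_conj hA P)]
  exact Finset.sum_congr rfl fun j hj => hP.2.2 (j + 1) (by omega)
    (by have := Finset.mem_range.mp hj; omega)

theorem eigGap_nonneg (hk : 1 ≤ k) (hkn : k < n) {A : Matrix (Fin n) (Fin n) ℝ} (hA : Aᵀ = A) :
    0 ≤ eigGap k A :=
  sub_nonneg.mpr (eigval_antitone hA hk (Nat.le_succ k) hkn)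

/-- The trace gain controls the spectral gap times the squared distance of the column spaces. -/
theorem IsTopEigenbasis.eigGap_mul_le (hk : 1 ≤ k) (hkn : k < n) {A : Matrix (Fin n) (Fin n) ℝ}
    (hA : Aᵀ = A) {X P : Matrix (Fin n) (Fin k) ℝ} (hX : IsTopEigenbasis A X)
    (hP : P ∈ stiefel n k) :
    eigGap k A * (k - ‖Xᵀ * P‖ ^ 2) ≤ (Xᵀ * A * X).trace - (Pᵀ * A * P).trace := by
  have hKF := trace_conj_le hk hkn.le hA hP
  rw [← hX.trace_eq hA] at hKF
  -- With zero gap the top eigenspace need not be unique, but the left side is then zero and Ky Fan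
  -- suffices.
  rcases (eigGap_nonneg hk hkn hA).eq_or_lt with h0 | hpos
  · rw [← h0, zero_mul]; linarith
  obtain ⟨U, d, hU, hU', hAd, hd, hv⟩ := exists_spectral_decomposition hA
  have hUt : Uᵀ ∈ stiefel n n := by simpa [stiefel] using hU'
  have hB := mul_mem_stiefel hUt hP
  have hC := mul_mem_stiefel hUt hX.1
  obtain ⟨p, hp⟩ : ∃ p : Fin n, (p : ℕ) + 1 = k := ⟨⟨k - 1, by omega⟩, by simp; omega⟩
  obtain ⟨q, hq⟩ : ∃ q : Fin n, (q : ℕ) = k := ⟨⟨k, hkn⟩, rfl⟩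
  have hgap : eigGap k A = d p - d q := by rw [eigGap, ← hv p, ← hv q, hp, hq]
  have hXt : (Xᵀ * A * X).trace = ∑ j : Fin n, if (j : ℕ) < k then d j else 0 := by
    rw [hX.trace_eq hA, sum_top_eq_sum_eigval hkn.le hv]
  have hX' : (Xᵀ * A * X).trace = ∑ j, d j * ((Uᵀ * X) * (Uᵀ * X)ᵀ) j j := by
    conv_lhs => rw [hAd]
    rw [conj_spectral, trace_diagonal_conj]
  have hP' : (Pᵀ * A * P).trace = ∑ j, d j * ((Uᵀ * P) * (Uᵀ * P)ᵀ) j j := by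
    conv_lhs => rw [hAd]
    rw [conj_spectral, trace_diagonal_conj]
  have hgX := gap_mul_le_sum_top_sub hC hd p q hp hq
  rw [← hXt, ← hX', sub_self, ← hgap] at hgX
  -- `X` attains the Ky Fan bound, so a positive gap leaves it no weight outside the top `k`
  -- coordinates. Hence `‖Xᵀ P‖²` is the total top weight of `P`.
  have hzero : ∑ j : Fin n, (if (j : ℕ) < k then 0 else ((Uᵀ * X) * (Uᵀ * X)ᵀ) j j) = 0 := by
    refine le_antisymm (by by_contra h; push Not at h; nlinarith) (Finset.sum_nonneg fun j _ => ?_)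
    split_ifs
    exacts [le_rfl, weight_nonneg _ j]
  have hE := mul_transpose_eq_of_sum_eq_zero hkn.le hC hzero
  have hnorm : ‖Xᵀ * P‖ ^ 2 =
      ∑ j : Fin n, (if (j : ℕ) < k then ((Uᵀ * P) * (Uᵀ * P)ᵀ) j j else 0) := by
    have h1 : Xᵀ * P = (Uᵀ * X)ᵀ * (Uᵀ * P) := by
      rw [Matrix.transpose_mul, Matrix.transpose_transpose, Matrix.mul_assoc, ← Matrix.mul_assoc U,
        hU', Matrix.one_mul]
    rw [frobenius_norm_sq, h1, Matrix.transpose_mul, Matrix.transpose_transpose, Matrix.mul_assoc,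
      ← Matrix.mul_assoc (Uᵀ * X), hE, ← Matrix.mul_assoc, trace_diagonal_conj]
    simp only [ite_mul, one_mul, zero_mul]
  have hcompl : (k : ℝ) - ‖Xᵀ * P‖ ^ 2 =
      ∑ j : Fin n, (if (j : ℕ) < k then 0 else ((Uᵀ * P) * (Uᵀ * P)ᵀ) j j) := by
    rw [hnorm, ← sum_weight hB, ← Finset.sum_sub_distrib]
    refine Finset.sum_congr rfl fun j _ => ?_
    split_ifs <;> ring
  rw [hcompl, hgap, hXt, hP']
  exact gap_mul_le_sum_top_sub hB hd p q hp hq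

/-! ### Projection and residual estimates -/

/-- Pythagoras for the projection `P Pᵀ`: `‖A‖² = ‖A P‖² + ‖A (1 - P Pᵀ)‖²`. -/
theorem norm_mul_le_of_mem_stiefel {m : ℕ} (A : Matrix (Fin m) (Fin n) ℝ)
    {P : Matrix (Fin n) (Fin k) ℝ} (hP : P ∈ stiefel n k) : ‖A * P‖ ≤ ‖A‖ := by
  have h1 : ‖A‖ ^ 2 - ‖A * P‖ ^ 2 = ‖A * (1 - P * Pᵀ)‖ ^ 2 := by
    have h2 : (1 - P * Pᵀ) * (1 - P * Pᵀ)ᵀ = 1 - P * Pᵀ := by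
      have h3 : P * Pᵀ * (P * Pᵀ) = P * Pᵀ := by
        rw [Matrix.mul_assoc, ← Matrix.mul_assoc Pᵀ, hP, Matrix.one_mul]
      simp [Matrix.mul_sub, Matrix.sub_mul, h3]
    rw [frobenius_norm_sq, frobenius_norm_sq, frobenius_norm_sq, Matrix.trace_mul_comm Aᵀ,
      Matrix.trace_mul_comm (A * P)ᵀ, Matrix.trace_mul_comm (A * (1 - P * Pᵀ))ᵀ,
      Matrix.transpose_mul A (1 - P * Pᵀ), Matrix.mul_assoc A (1 - P * Pᵀ),
      ← Matrix.mul_assoc (1 - P * Pᵀ) (1 - P * Pᵀ)ᵀ, h2, ← Matrix.trace_sub]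
    simp [Matrix.transpose_mul, Matrix.mul_sub, Matrix.sub_mul, Matrix.mul_assoc]
  have h4 := sq_nonneg ‖A * (1 - P * Pᵀ)‖
  exact le_of_sq_le_sq (by linarith) (norm_nonneg _)

theorem norm_transpose_mul_sq_le {X Y : Matrix (Fin n) (Fin k) ℝ} (hX : X ∈ stiefel n k)
    (hY : Y ∈ stiefel n k) : ‖Xᵀ * Y‖ ^ 2 ≤ k := by
  have h1 : ‖Xᵀ * Y‖ ≤ ‖X‖ := by
    rw [← Matrix.frobenius_norm_transpose X]; exact norm_mul_le_of_mem_stiefel _ hY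
  have h2 : ‖X‖ ^ 2 = k := by rw [frobenius_norm_sq, show Xᵀ * X = 1 from hX]; simp
  rw [← h2]
  gcongr

theorem norm_sub_proj_sq {X Y : Matrix (Fin n) (Fin k) ℝ} (hX : X ∈ stiefel n k)
    (hY : Y ∈ stiefel n k) : ‖Y - X * (Xᵀ * Y)‖ ^ 2 = k - ‖Xᵀ * Y‖ ^ 2 := by
  rw [frobenius_norm_sq, frobenius_norm_sq]
  have h : (Y - X * (Xᵀ * Y))ᵀ * (Y - X * (Xᵀ * Y)) = 1 - (Xᵀ * Y)ᵀ * (Xᵀ * Y) := by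
    have h1 : Yᵀ * (X * (Xᵀ * (X * (Xᵀ * Y)))) = Yᵀ * (X * (Xᵀ * Y)) := by
      rw [← Matrix.mul_assoc Xᵀ X, show Xᵀ * X = 1 from hX, Matrix.one_mul]
    simp [Matrix.transpose_sub, Matrix.transpose_mul, Matrix.mul_sub, Matrix.sub_mul,
      Matrix.mul_assoc, h1, show Yᵀ * Y = 1 from hY]
  rw [h, Matrix.trace_sub]
  simp

/-- The eigen-residual is bounded by the distance to an invariant subspace. -/
theorem norm_residual_sq_le {A : Matrix (Fin n) (Fin n) ℝ} (hA : Aᵀ = A)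
    {X P : Matrix (Fin n) (Fin k) ℝ} (hX : X ∈ stiefel n k) (hAX : A * X = X * (Xᵀ * A * X))
    (hP : P ∈ stiefel n k) :
    ‖A * P - P * (Pᵀ * A * P)‖ ^ 2 ≤ 4 * ‖A‖ ^ 2 * (k - ‖Xᵀ * P‖ ^ 2) := by
  have hnX : ‖P - X * (Xᵀ * P)‖ ^ 2 = k - ‖Xᵀ * P‖ ^ 2 := norm_sub_proj_sq hX hP
  have hnP : ‖X - P * (Pᵀ * X)‖ ^ 2 = k - ‖Xᵀ * P‖ ^ 2 := by
    rw [norm_sub_proj_sq hP hX, ← Matrix.frobenius_norm_transpose (Pᵀ * X)]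
    simp
  have heq : ‖X - P * (Pᵀ * X)‖ = ‖P - X * (Xᵀ * P)‖ :=
    (sq_eq_sq₀ (norm_nonneg _) (norm_nonneg _)).mp (hnP.trans hnX.symm)
  have hXA : Xᵀ * A = (Xᵀ * A * X) * Xᵀ := by
    have := congrArg Matrix.transpose hAX
    rwa [Matrix.transpose_mul, Matrix.transpose_mul, transpose_conj hA, hA] at this
  -- Split `P` into its part in the range of `X` and the rest, apply `A`, then project by `1 - P
  -- Pᵀ`. By `heq` each piece is at most `‖A‖` times the same distance, whence the factor 2, squared
  -- to 4.
  have hdec : A * P - P * (Pᵀ * A * P) =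
      (X - P * (Pᵀ * X)) * (Xᵀ * A * P) +
        (A * (P - X * (Xᵀ * P)) - P * (Pᵀ * (A * (P - X * (Xᵀ * P))))) := by
    have h1 : A * (X * (Xᵀ * P)) = X * (Xᵀ * A * P) := by
      rw [← Matrix.mul_assoc, hAX, Matrix.mul_assoc X, ← Matrix.mul_assoc (Xᵀ * A * X), ← hXA]
    rw [Matrix.mul_sub A, h1]
    simp only [Matrix.sub_mul, Matrix.mul_sub, Matrix.mul_assoc]
    abel
  have hproj : ∀ Y : Matrix (Fin n) (Fin k) ℝ, ‖Y - P * (Pᵀ * Y)‖ ≤ ‖Y‖ := by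
    intro Y
    have h2 : ‖Y‖ ^ 2 - ‖Y - P * (Pᵀ * Y)‖ ^ 2 = ‖Pᵀ * Y‖ ^ 2 := by
      rw [frobenius_norm_sq, frobenius_norm_sq, frobenius_norm_sq, ← Matrix.trace_sub]
      have h3 : Yᵀ * (P * (Pᵀ * (P * (Pᵀ * Y)))) = Yᵀ * (P * (Pᵀ * Y)) := by
        rw [← Matrix.mul_assoc Pᵀ P, show Pᵀ * P = 1 from hP, Matrix.one_mul]
      congr 1
      simp [Matrix.transpose_sub, Matrix.transpose_mul, Matrix.mul_sub, Matrix.sub_mul,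
        Matrix.mul_assoc, h3]
    have h4 := sq_nonneg ‖Pᵀ * Y‖
    exact le_of_sq_le_sq (by linarith) (norm_nonneg _)
  have hb1 : ‖Xᵀ * A * P‖ ≤ ‖A‖ := by
    refine (norm_mul_le_of_mem_stiefel _ hP).trans ?_
    rw [← Matrix.frobenius_norm_transpose, Matrix.transpose_mul, Matrix.transpose_transpose, hA]
    exact norm_mul_le_of_mem_stiefel _ hX
  have hb : ‖A * P - P * (Pᵀ * A * P)‖ ≤ 2 * ‖A‖ * ‖P - X * (Xᵀ * P)‖ := by
    rw [hdec]
    refine (norm_add_le _ _).trans ?_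
    have h5 : ‖(X - P * (Pᵀ * X)) * (Xᵀ * A * P)‖ ≤ ‖P - X * (Xᵀ * P)‖ * ‖A‖ := by
      refine (Matrix.frobenius_norm_mul _ _).trans ?_
      rw [heq]
      gcongr
    have h6 := (hproj (A * (P - X * (Xᵀ * P)))).trans (Matrix.frobenius_norm_mul _ _)
    linarith
  calc _ ≤ (2 * ‖A‖ * ‖P - X * (Xᵀ * P)‖) ^ 2 := by gcongr
    _ = _ := by rw [← hnX]; ring

/-! ### Canonical angles -/

theorem sq_singularValues_eq_eigval {m p : ℕ} (M : Matrix (Fin m) (Fin p) ℝ) (j : Fin p) :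
    (Matrix.toEuclideanLin M).singularValues j ^ 2 = eigval (Mᵀ * M) (j + 1) := by
  have hH : (Mᵀ * M).IsHermitian := by
    rw [Matrix.IsHermitian, Matrix.conjTranspose_eq_transpose_of_trivial, Matrix.transpose_mul,
      Matrix.transpose_transpose]
  have hadj : (Matrix.toEuclideanLin M).adjoint ∘ₗ Matrix.toEuclideanLin M =
      Matrix.toEuclideanLin (Mᵀ * M) := by
    rw [← Matrix.toEuclideanLin_conjTranspose_eq_adjoint,
      Matrix.conjTranspose_eq_transpose_of_trivial]
    exact (Matrix.toLpLin_mul 2 2 2 Mᵀ M).symm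
  rw [eigval, dif_pos ⟨hH, by omega, by omega⟩, Matrix.IsHermitian.eigenvalues₀,
    (Matrix.toEuclideanLin M).sq_singularValues_of_lt finrank_euclideanSpace
      (by rw [Fintype.card_fin]; exact j.2)]
  congr 1

/-- The squared Frobenius norm of the sines of the canonical angles. -/
theorem norm_sinTheta_sq {X Y : Matrix (Fin n) (Fin k) ℝ} (hX : X ∈ stiefel n k)
    (hY : Y ∈ stiefel n k) : ‖sinTheta X Y‖ ^ 2 = k - ‖Xᵀ * Y‖ ^ 2 := by
  set M := Xᵀ * Y with hM
  have hMs : (Mᵀ * M)ᵀ = Mᵀ * M := by simp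
  -- `1 - MᵀM` is the Gram matrix of `Y - X Xᵀ Y`, hence positive semidefinite. This is needed
  -- because `sin (arccos σ) = √(1 - σ²)`, where a negative radicand would be truncated to zero.
  have hle : ∀ j : Fin k, eigval (Mᵀ * M) (j + 1) ≤ 1 := by
    intro j
    obtain ⟨V, d, hV, -, hMd, -, hv⟩ := exists_spectral_decomposition hMs
    rw [hv]
    let R := (Y - X * (Xᵀ * Y)) * V
    have hR : Rᵀ * R = Matrix.diagonal fun j => 1 - d j := by
      have h1 : Yᵀ * (X * (Xᵀ * (X * (Xᵀ * Y)))) = Yᵀ * (X * (Xᵀ * Y)) := by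
        rw [← Matrix.mul_assoc Xᵀ X, show Xᵀ * X = 1 from hX, Matrix.one_mul]
      have h2 : (Y - X * (Xᵀ * Y))ᵀ * (Y - X * (Xᵀ * Y)) = 1 - Mᵀ * M := by
        simp [M, Matrix.transpose_sub, Matrix.transpose_mul, Matrix.mul_sub, Matrix.sub_mul,
          Matrix.mul_assoc, h1, show Yᵀ * Y = 1 from hY]
      calc Rᵀ * R = Vᵀ * ((Y - X * (Xᵀ * Y))ᵀ * (Y - X * (Xᵀ * Y))) * V := by
            simp only [R, Matrix.transpose_mul, Matrix.mul_assoc]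
        _ = Vᵀ * V - (Vᵀ * V) * Matrix.diagonal d * (Vᵀ * V) := by
            rw [h2, hMd]; simp only [Matrix.mul_sub, Matrix.sub_mul, Matrix.mul_assoc,
              Matrix.mul_one]
        _ = _ := by
            rw [hV, Matrix.one_mul, Matrix.mul_one, ← Matrix.diagonal_one, Matrix.diagonal_sub]
    have h3 := congrFun (congrFun hR j) j
    rw [Matrix.mul_apply, Matrix.diagonal_apply_eq] at h3
    have h4 : 0 ≤ ∑ i, Rᵀ j i * R i j := Finset.sum_nonneg fun i _ => mul_self_nonneg (R i j)
    linarith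
  have h1 : ∀ j : Fin k, Real.sin (canonicalAngle X Y j) * Real.sin (canonicalAngle X Y j) =
      1 - eigval (Mᵀ * M) (j + 1) := by
    intro j
    rw [canonicalAngle, Real.sin_arccos, sq_singularValues_eq_eigval,
      Real.mul_self_sqrt (sub_nonneg.mpr (hle j))]
  rw [frobenius_norm_sq, frobenius_norm_sq, sinTheta, Matrix.diagonal_transpose,
    Matrix.diagonal_mul_diagonal, Matrix.trace_diagonal, Finset.sum_congr rfl fun j _ => h1 j,
    Finset.sum_sub_distrib, trace_eq_sum_eigval hMs,
    Fin.sum_univ_eq_sum_range fun j => eigval (Mᵀ * M) (j + 1)]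
  simp

/-! ### Compactness of the Stiefel manifold -/

theorem isClosed_stiefel : IsClosed (stiefel n k) := by
  refine isClosed_eq ?_ continuous_const
  exact Continuous.matrix_mul continuous_id.matrix_transpose continuous_id

theorem isCompact_stiefel : IsCompact (stiefel n k) := by
  have : ProperSpace (Matrix (Fin n) (Fin k) ℝ) := FiniteDimensional.proper_real _
  refine Metric.isCompact_of_isClosed_isBounded isClosed_stiefel ?_
  refine isBounded_iff_forall_norm_le.mpr ⟨√k, fun X hX => ?_⟩
  refine Real.le_sqrt_of_sq_le ?_
  rw [frobenius_norm_sq, show Xᵀ * X = 1 from hX]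
  simp

theorem stiefel_subset_stiefelNhd {δ : ℝ} (hδ : 0 < δ) : stiefel n k ⊆ stiefelNhd n k δ := by
  intro X hX
  change ‖Xᵀ * X - 1‖ < δ
  rwa [show Xᵀ * X = 1 from hX, sub_self, norm_zero]

/-! ### Convergence of the SCF iteration -/

variable {f : Matrix (Fin n) (Fin k) ℝ → ℝ}
  {H : Matrix (Fin n) (Fin k) ℝ → Matrix (Fin n) (Fin n) ℝ}
  {S : Set (Matrix (Fin n) (Fin k) ℝ)} {ω : ℝ} {P : ℕ → Matrix (Fin n) (Fin k) ℝ}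

/-- The trace deficit of an orthonormal frame `X` with respect to the `k` largest eigenvalues. -/
noncomputable def traceDeficit (A : Matrix (Fin n) (Fin n) ℝ) (X : Matrix (Fin n) (Fin k) ℝ) : ℝ :=
  ∑ j ∈ Finset.range k, eigval A (j + 1) - (Xᵀ * A * X).trace

theorem IsSCFSequence.mem (hP : IsSCFSequence f H S ω P) (i : ℕ) : P i ∈ S := by
  cases i with
  | zero => exact hP.1
  | succ i =>
    obtain ⟨X, Q, -, hQ, h⟩ := hP.2 i
    exact h ▸ hQ.2.1

/-- Every top eigenbasis has trace equal to the sum of the `k` largest eigenvalues, so the gain does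
not depend on the basis chosen in the step. -/
theorem IsSCFSequence.ascent (hA : Ansatz f H S ω) (hP : IsSCFSequence f H S ω P) (i : ℕ) :
    f (P i) + ω * traceDeficit (H (P i)) (P i) ≤ f (P (i + 1)) := by
  obtain ⟨X, Q, hX, hQ, h⟩ := hP.2 i
  have h1 := hQ.2.2
  rwa [hX.trace_eq (hA.symm _ (hA.subset_stiefel (hP.mem i))), ← h] at h1

theorem IsSCFSequence.traceDeficit_nonneg (hk : 1 ≤ k) (hkn : k ≤ n) (hA : Ansatz f H S ω)
    (hP : IsSCFSequence f H S ω P) (i : ℕ) : 0 ≤ traceDeficit (H (P i)) (P i) :=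
  sub_nonneg.mpr (trace_conj_le hk hkn (hA.symm _ (hA.subset_stiefel (hP.mem i)))
    (hA.subset_stiefel (hP.mem i)))

theorem IsSCFSequence.monotone (hk : 1 ≤ k) (hkn : k ≤ n) (hA : Ansatz f H S ω)
    (hP : IsSCFSequence f H S ω P) : Monotone fun i => f (P i) := by
  refine monotone_nat_of_le_succ fun i => ?_
  have h1 := mul_nonneg hA.omega_pos.le (hP.traceDeficit_nonneg hk hkn hA i)
  linarith [hP.ascent hA i]

theorem IsSCFSequence.bddAbove (hf : ContinuousOn f (stiefel n k)) (hA : Ansatz f H S ω)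
    (hP : IsSCFSequence f H S ω P) : BddAbove (Set.range fun i => f (P i)) := by
  refine (isCompact_stiefel.bddAbove_image hf).mono ?_
  rintro _ ⟨i, rfl⟩
  exact ⟨P i, hA.subset_stiefel (hP.mem i), rfl⟩

theorem IsSCFSequence.summable_traceDeficit (hk : 1 ≤ k) (hkn : k ≤ n)
    (hf : ContinuousOn f (stiefel n k)) (hA : Ansatz f H S ω) (hP : IsSCFSequence f H S ω P) :
    Summable fun i => traceDeficit (H (P i)) (P i) := by
  obtain ⟨C, hC⟩ := hP.bddAbove hf hA
  refine summable_of_sum_range_le (c := (C - f (P 0)) / ω)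
    (hP.traceDeficit_nonneg hk hkn hA) fun m => ?_
  rw [le_div_iff₀' hA.omega_pos, Finset.mul_sum]
  calc ∑ i ∈ Finset.range m, ω * traceDeficit (H (P i)) (P i)
      ≤ ∑ i ∈ Finset.range m, (f (P (i + 1)) - f (P i)) :=
        Finset.sum_le_sum fun i _ => by linarith [hP.ascent hA i]
    _ = f (P m) - f (P 0) := Finset.sum_range_sub (fun i => f (P i)) m
    _ ≤ C - f (P 0) := by linarith [hC ⟨m, rfl⟩]

theorem tendsto_trace_conj {ι : Type*} {l : Filter ι} {A : ι → Matrix (Fin n) (Fin n) ℝ}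
    {Y : ι → Matrix (Fin n) (Fin k) ℝ} {A₀ : Matrix (Fin n) (Fin n) ℝ}
    {Y₀ : Matrix (Fin n) (Fin k) ℝ} (hA : Tendsto A l (𝓝 A₀)) (hY : Tendsto Y l (𝓝 Y₀)) :
    Tendsto (fun i => ((Y i)ᵀ * A i * Y i).trace) l (𝓝 (Y₀ᵀ * A₀ * Y₀).trace) := by
  have hcont : Continuous fun p : Matrix (Fin n) (Fin n) ℝ × Matrix (Fin n) (Fin k) ℝ =>
      (p.2ᵀ * p.1 * p.2).trace := by
    refine Continuous.matrix_trace (Continuous.matrix_mul (Continuous.matrix_mul ?_ ?_) ?_)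
    · exact continuous_snd.matrix_transpose
    · exact continuous_fst
    · exact continuous_snd
  exact Tendsto.comp (f := fun i => (A i, Y i)) (hcont.tendsto' (A₀, Y₀) _ rfl)
    (hA.prodMk_nhds hY)

/-- Accumulation points of the iteration are self-consistent. -/
theorem IsSCFSequence.isTopEigenbasis_of_mapClusterPt (hk : 1 ≤ k) (hkn : k ≤ n)
    (hf : ContinuousOn f (stiefel n k)) (hA : Ansatz f H S ω) (hP : IsSCFSequence f H S ω P)
    (hH : ContinuousOn H (stiefel n k)) {X : Matrix (Fin n) (Fin k) ℝ}
    (hX : MapClusterPt X atTop P) : IsTopEigenbasis (H X) X := by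
  have : FirstCountableTopology (Matrix (Fin n) (Fin k) ℝ) :=
    inferInstanceAs (FirstCountableTopology (Fin n → Fin k → ℝ))
  obtain ⟨φ, hφ, hlim⟩ := hX.tendsto_subseq
  have hmem : ∀ i, P i ∈ stiefel n k := fun i => hA.subset_stiefel (hP.mem i)
  have hXs : X ∈ stiefel n k :=
    isClosed_stiefel.mem_of_tendsto hlim (Eventually.of_forall fun i => hmem _)
  have hHlim : Tendsto (fun i => H (P (φ i))) atTop (𝓝 (H X)) :=
    (hH X hXs).tendsto.comp
      (tendsto_nhdsWithin_iff.mpr ⟨hlim, Eventually.of_forall fun i => hmem _⟩)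
  have hdef : Tendsto (fun i => traceDeficit (H (P (φ i))) (P (φ i))) atTop (𝓝 0) :=
    (hP.summable_traceDeficit hk hkn hf hA).tendsto_atTop_zero.comp hφ.tendsto_atTop
  -- For fixed `Y`, Ky Fan bounds its trace by that of `P (φ i)` plus the deficit. Only traces pass
  -- to the limit, so continuity of eigenvalues is not needed.
  refine isTopEigenbasis_of_trace_max hk hkn (hA.symm X hXs) hXs fun Y hY => ?_
  have h := (tendsto_trace_conj hHlim hlim).add hdef
  rw [add_zero] at h
  refine le_of_tendsto_of_tendsto' (tendsto_trace_conj hHlim (tendsto_const_nhds (x := Y))) h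
    fun i => ?_
  have := trace_conj_le hk hkn (hA.symm _ (hmem (φ i))) hY
  rw [traceDeficit]
  dsimp only [Function.comp_apply]
  linarith

/-- A self-consistent point satisfies the KKT conditions when the multiplier is symmetric. -/
theorem IsTopEigenbasis.isKKTPoint (hA : Ansatz f H S ω) {X : Matrix (Fin n) (Fin k) ℝ}
    (hX : IsTopEigenbasis (H X) X) {M : Matrix (Fin k) (Fin k) ℝ}
    (hM : H X * X - euclGrad f X = X * M) (hMs : Mᵀ = M) : IsKKTPoint f X := by
  refine ⟨hX.1, Xᵀ * H X * X - M, ?_, ?_⟩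
  · rw [Matrix.transpose_sub, transpose_conj (hA.symm X hX.1), hMs]
  · rw [Matrix.mul_sub, ← hX.2.1, ← hM, sub_sub_cancel]

/-- For `k = n` all frames span the whole space. -/
theorem norm_transpose_mul_sq_of_square {X Y : Matrix (Fin n) (Fin n) ℝ} (hX : X ∈ stiefel n n)
    (hY : Y ∈ stiefel n n) : ‖Xᵀ * Y‖ ^ 2 = n := by
  have hXX : X * Xᵀ = 1 := mul_eq_one_comm.mp hX
  rw [frobenius_norm_sq, Matrix.transpose_mul, Matrix.transpose_transpose, Matrix.mul_assoc,
    ← Matrix.mul_assoc X, hXX, Matrix.one_mul, show Yᵀ * Y = 1 from hY]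
  simp

/-- The terms of both series are nonnegative and bounded by the trace deficit. -/
theorem IsSCFSequence.eigGap_mul_bounds (hk : 1 ≤ k) (hkn : k ≤ n) (hA : Ansatz f H S ω)
    (hP : IsSCFSequence f H S ω P) (i : ℕ) :
    (0 ≤ eigGap k (H (P i)) * ‖sinTheta (P (i + 1)) (P i)‖ ^ 2 ∧
      eigGap k (H (P i)) * ‖sinTheta (P (i + 1)) (P i)‖ ^ 2 ≤ traceDeficit (H (P i)) (P i)) ∧
    0 ≤ eigGap k (H (P i)) *
        (‖H (P i) * P i - P i * ((P i)ᵀ * H (P i) * P i)‖ ^ 2 / ‖H (P i)‖ ^ 2) ∧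
      eigGap k (H (P i)) *
        (‖H (P i) * P i - P i * ((P i)ᵀ * H (P i) * P i)‖ ^ 2 / ‖H (P i)‖ ^ 2) ≤
        4 * traceDeficit (H (P i)) (P i) := by
  have hmem : ∀ i, P i ∈ stiefel n k := fun i => hA.subset_stiefel (hP.mem i)
  have hs := hA.symm _ (hmem i)
  have hη := hP.traceDeficit_nonneg hk hkn hA i
  obtain ⟨X, Q, hX, hQ, hPX⟩ := hP.2 i
  have hQ1 : Q * Qᵀ = 1 := mul_eq_one_comm.mp hQ.1
  -- `P (i + 1) = X Q` spans the same space as `X`; the orthogonal factor drops out of the norm.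
  have hsin : ‖sinTheta (P (i + 1)) (P i)‖ ^ 2 = k - ‖Xᵀ * P i‖ ^ 2 := by
    rw [norm_sinTheta_sq (hmem _) (hmem _), hPX, Matrix.transpose_mul, Matrix.mul_assoc,
      frobenius_norm_sq, frobenius_norm_sq, Matrix.transpose_mul, Matrix.mul_assoc,
      ← Matrix.mul_assoc Qᵀᵀ, Matrix.transpose_transpose, hQ1, Matrix.one_mul]
  have hres := norm_residual_sq_le hs hX.1 hX.2.1 (hmem i)
  have hratio : ‖H (P i) * P i - P i * ((P i)ᵀ * H (P i) * P i)‖ ^ 2 / ‖H (P i)‖ ^ 2 ≤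
      4 * (k - ‖Xᵀ * P i‖ ^ 2) := by
    -- This bound includes `H (P i) = 0`, where the quotient is zero by convention.
    refine div_le_of_le_mul₀ (sq_nonneg _) ?_ (by linarith)
    linarith [norm_transpose_mul_sq_le hX.1 (hmem i)]
  have hratio0 : 0 ≤ ‖H (P i) * P i - P i * ((P i)ᵀ * H (P i) * P i)‖ ^ 2 / ‖H (P i)‖ ^ 2 := by
    positivity
  rw [hsin]
  -- For `k = n` the gap is `λ_n - 0` and may be negative, so the terms are bounded by showing that
  -- their other factors vanish.
  rcases hkn.eq_or_lt with rfl | hlt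
  · have h0 := norm_transpose_mul_sq_of_square hX.1 (hmem i)
    rw [h0, sub_self, mul_zero] at hratio
    rw [h0, sub_self, le_antisymm hratio hratio0, mul_zero]
    exact ⟨⟨le_rfl, hη⟩, le_rfl, by linarith⟩
  · have hg := eigGap_nonneg hk hlt hs
    have h1 := hX.eigGap_mul_le hk hlt hs (hmem i)
    rw [hX.trace_eq hs] at h1
    have h2 := norm_transpose_mul_sq_le hX.1 (hmem i)
    refine ⟨⟨mul_nonneg hg (by linarith), h1⟩, mul_nonneg hg hratio0, ?_⟩
    refine (mul_le_mul_of_nonneg_left hratio hg).trans ?_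
    rw [traceDeficit]
    linarith

end NEPv

theorem mainTheorem2 {n k : ℕ} (hk : 1 ≤ k) (hkn : k ≤ n)
    (f : Matrix (Fin n) (Fin k) ℝ → ℝ)
    (H : Matrix (Fin n) (Fin k) ℝ → Matrix (Fin n) (Fin n) ℝ)
    (S : Set (Matrix (Fin n) (Fin k) ℝ)) (ω δ : ℝ)
    (hδ : 0 < δ) (hf : DifferentiableOn ℝ f (NEPv.stiefelNhd n k δ))
    (hA : NEPv.Ansatz f H S ω)
    (P : ℕ → Matrix (Fin n) (Fin k) ℝ) (hP : NEPv.IsSCFSequence f H S ω P) :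
    -- (a) monotone convergence of the objective values
    (Monotone (fun i => f (P i)) ∧ ∃ l : ℝ, Tendsto (fun i => f (P i)) atTop (𝓝 l)) ∧
    -- (b) accumulation points
    (ContinuousOn H (NEPv.stiefel n k) →
      ∀ Pstar : Matrix (Fin n) (Fin k) ℝ, MapClusterPt Pstar atTop P →
        NEPv.IsTopEigenbasis (H Pstar) Pstar ∧
        ∀ M : Matrix (Fin n) (Fin k) ℝ → Matrix (Fin k) (Fin k) ℝ,
          (∀ X ∈ NEPv.stiefel n k, H X * X - NEPv.euclGrad f X = X * M X) →
          (M Pstar)ᵀ = M Pstar → NEPv.IsKKTPoint f Pstar) ∧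
    -- (c) the two convergent series
    (Summable (fun i : ℕ =>
        NEPv.eigGap k (H (P (i + 1))) * ‖NEPv.sinTheta (P (i + 1 + 1)) (P (i + 1))‖ ^ 2) ∧
      Summable (fun i : ℕ =>
        NEPv.eigGap k (H (P (i + 1))) *
          (‖H (P (i + 1)) * P (i + 1)
              - P (i + 1) * ((P (i + 1))ᵀ * H (P (i + 1)) * P (i + 1))‖ ^ 2
            / ‖H (P (i + 1))‖ ^ 2))) := by
  have hfc : ContinuousOn f (NEPv.stiefel n k) :=
    (hf.mono (NEPv.stiefel_subset_stiefelNhd hδ)).continuousOn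
  -- Both series start at index 1, hence the shift.
  have hsum := (summable_nat_add_iff 1).mpr (hP.summable_traceDeficit hk hkn hfc hA)
  have hstep := fun i => hP.eigGap_mul_bounds hk hkn hA (i + 1)
  have hmono := hP.monotone hk hkn hA
  refine ⟨⟨hmono, _, tendsto_atTop_ciSup hmono (hP.bddAbove hfc hA)⟩, ?_, ?_, ?_⟩
  · intro hH X hX
    have h := hP.isTopEigenbasis_of_mapClusterPt hk hkn hfc hA hH hX
    exact ⟨h, fun M hM hMs => h.isKKTPoint hA (hM X h.1) hMs⟩
  · exact hsum.of_nonneg_of_le (fun i => (hstep i).1.1) fun i => (hstep i).1.2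
  · exact (hsum.mul_left 4).of_nonneg_of_le (fun i => (hstep i).2.1) fun i => (hstep i).2.2
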